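/- For $N\ge 1$ let $\mathcal M_{N,N}$ be the space of complex $N\times N$ matrices with the Frobenius norm, with entries indexed by $0\le j,l\le N-1$ and regarded as a real vector space. Let $\mathcal H_N\subset\mathcal M_{N,N}$ be the set of Hankel matrices ($A(j,l)=A(j',l')$ whenever $j+l=j'+l'$), $\mathcal R_{N,r}$ the set of matrices of rank at most $r$, and $\mathcal H_{N,r}=\mathcal R_{N,r}\cap\mathcal H_N$. Let $0\le r<N$. If $A\in\mathcal H_{N,r}$ has a nonsingular upper left $r\times r$ corner, then there are unique $\lambda_0,\dots,\lambda_{r-1}\in\mathbb C$ such that $A(j,l)=f(j+l)$ for a sequence $f:\{0,1,2,\dots\}\to\mathbb C$ with $f(k+r)+\sum_{l=0}^{r-1}\lambda_l f(k+l)=0$ for all $k\ge 0$; the polynomial $P(x)=x^r+\sum_{l=0}^{r-1}\lambda_l x^l$ is called the central polynomial of $A$. Let $\mathcal H^n_{N,r}$ be the set of those $A\in\mathcal H_{N,r}$ whose upper left $r\times r$ corner is nonsingular and whose central polynomial has only simple and nonzero roots. A set is called thin relatively to a $d$-dimensional manifold if it is contained in the union of finitely many manifolds of dimension lower than $d$.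 (Manifolds are smooth embedded submanifolds of $\mathcal M_{N,N}$.) Then: 1. $\mathcal H_N$ is a real linear subspace of $\mathcal M_{N,N}$ of dimension $2(2N-1)$. 2. $\mathcal H^n_{N,r}$ is a real differentiable manifold of dimension $4r$ which is dense in $\mathcal H_{N,r}$. Its complement $\mathcal H_{N,r}\setminus\mathcal H^n_{N,r}$ is thin relatively to $\mathcal H^n_{N,r}$. 3. The projection $\pi_{\mathcal R_{N,r}}$ is well defined at all points of $\mathcal H^n_{N,r}$: every $A\in\mathcal H^n_{N,r}$ has a unique closest point in $\mathcal R_{N,r}$ with respect to the Frobenius norm. -/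

import Mathlib

open scoped ContDiff

/- The space of complex `N × N` matrices carries the Frobenius norm, as a real normed space. -/
attribute [local instance] Matrix.frobeniusNormedAddCommGroup Matrix.frobeniusNormedSpace

namespace HankelApprox

/-- The complex `N × N` matrices, with indices running from `0` to `N - 1`. -/
abbrev Mat (N : ℕ) : Type := Matrix (Fin N) (Fin N) ℂ

/-- The set of Hankel matrices: the entries are constant along the antidiagonals. -/
def hankel (N : ℕ) : Set (Mat N) :=
  {A | ∀ j l j' l' : Fin N, (j : ℕ) + (l : ℕ) = (j' : ℕ) + (l' : ℕ) → A j l = A j' l'}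

/-- The set of matrices of rank at most `r`. -/
def rankLE (N r : ℕ) : Set (Mat N) := {A | A.rank ≤ r}

/-- The set of Hankel matrices of rank at most `r`. -/
def hankelRankLE (N r : ℕ) : Set (Mat N) := rankLE N r ∩ hankel N

/-- The upper left corner submatrix of order `r`. -/
def corner {N r : ℕ} (h : r ≤ N) (A : Mat N) : Matrix (Fin r) (Fin r) ℂ :=
  A.submatrix (Fin.castLE h) (Fin.castLE h)

/-- `P` is a central polynomial of order `r` of the finite Hankel matrix `A`: it is
`P = x ^ r + λ_{r-1} x ^ (r-1) + ... + λ_0`, where `A` extends to an infinite Hankel matrix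
`(f (j + l))_{j, l ≥ 0}` whose generating sequence satisfies the recursion
`f (k + r) + λ_{r-1} f (k + r - 1) + ... + λ_0 f k = 0` for all `k ≥ 0`.
If the corner of order `r` is nonsingular and `r < N`, then there is at most one such `P`, and
it exists if moreover `A` has rank `r`. -/
def IsCentralPolynomial {N : ℕ} (r : ℕ) (A : Mat N) (P : Polynomial ℂ) : Prop :=
  P.Monic ∧ P.natDegree = r ∧
    ∃ f : ℕ → ℂ, (∀ j l : Fin N, A j l = f ((j : ℕ) + (l : ℕ))) ∧
      ∀ k : ℕ, ∑ l ∈ Finset.range (r + 1), P.coeff l * f (k + l) = 0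

/-- The generic class: Hankel matrices of rank at most `r` whose upper left corner of order `r` is
nonsingular and whose central polynomial has only simple and nonzero roots. -/
def hankelGeneric (N r : ℕ) (h : r ≤ N) : Set (Mat N) :=
  {A | A ∈ hankelRankLE N r ∧ (corner h A).det ≠ 0 ∧
    ∃ P : Polynomial ℂ, IsCentralPolynomial r A P ∧
      ∀ z : ℂ, P.IsRoot z → z ≠ 0 ∧ P.rootMultiplicity z = 1}

/-- `S` is a (smooth, embedded) `d`-dimensional submanifold of the real normed space `E`: around
each of its points there is a smooth change of coordinates, defined on an open subset of `E`, which
flattens `S` to a `d`-dimensional linear subspace. -/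
def IsSubmanifold {E : Type*} [NormedAddCommGroup E] [NormedSpace ℝ E] (d : ℕ) (S : Set E) :
    Prop :=
  ∀ x ∈ S, ∃ (φ : OpenPartialHomeomorph E E) (W : Submodule ℝ E),
    x ∈ φ.source ∧
    ContDiffOn ℝ ∞ φ φ.source ∧ ContDiffOn ℝ ∞ φ.symm φ.target ∧
    FiniteDimensional ℝ W ∧ Module.finrank ℝ W = d ∧
    ∀ y ∈ φ.source, y ∈ S ↔ φ y ∈ W

/-- `T` is thin relatively to a `d`-dimensional manifold: it is contained in the union of finitely
many manifolds of dimension lower than `d`. -/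
def IsThin {E : Type*} [NormedAddCommGroup E] [NormedSpace ℝ E] (d : ℕ) (T : Set E) : Prop :=
  ∃ (n : ℕ) (S : Fin n → Set E) (e : Fin n → ℕ),
    (∀ i, e i < d ∧ IsSubmanifold (e i) (S i)) ∧ T ⊆ ⋃ i, S i

/-- `B` is a point of `S` which is closest to `A` in the Frobenius norm. -/
def IsClosestPoint {N : ℕ} (S : Set (Mat N)) (A B : Mat N) : Prop :=
  B ∈ S ∧ ∀ C ∈ S, ‖A - B‖ ≤ ‖A - C‖

end HankelApprox

/-! A Hankel matrix of order N is a sequence of 2N-1 antidiagonal values. The functional `pairing`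
with these moments turns kernel vectors into polynomials p with `pairing a (X ^ i * p) = 0`, that
is, into linear recursions. When the roots are simple and nonzero, such sequences are sums of r
exponentials, and a nonsingular corner means nonzero weights (`hankelCorner_mem_hankelGeneric_iff`).

By Cramer's rule the recursion of order s is polynomial in the first 2s terms. The remaining
equations are then affine and triangular in the later terms, hence independent, and counting them
gives the dimension (`isSubmanifold_stratum`).

If the rank is at most r, the kernel has dimension at least N-r, so it contains p of minimal degree
and another element of degree larger by at least N-r-1. The latter propagates the recursion p to all
but the last r - deg p antidiagonals, and minimality makes the corner of order deg p nonsingular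
(`exists_recursion_of_rank_le`). For deg p = s < r the stratum has dimension 2(r+s) < 4r. For s = r
a nongeneric matrix annihilates a nonzero polynomial in its first 2r terms, whose zero set is
covered by smooth hypersurfaces.

For density, p is deformed to a polynomial with simple nonzero roots, the sequence is carried along,
and the weights are finally made nonzero (`mem_closure_of_recursion`). -/

namespace HankelApprox

open Filter Topology

/-! ### Submanifolds from submersions. -/

section Manifold

variable {E V G : Type*} [NormedAddCommGroup E] [NormedSpace ℝ E] [FiniteDimensional ℝ E]
  [NormedAddCommGroup V] [NormedSpace ℝ V] [FiniteDimensional ℝ V]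
  [NormedAddCommGroup G] [NormedSpace ℝ G] [FiniteDimensional ℝ G]

/-- A smooth self-map with derivative the identity at `x` restricts, inside any neighbourhood
of `x`, to a smooth change of coordinates. -/
theorem exists_chart {Ψ : E → E} (hΨ : ContDiff ℝ ∞ Ψ) {x : E}
    (hx : HasFDerivAt Ψ (ContinuousLinearMap.id ℝ E) x) {U : Set E} (hU : U ∈ 𝓝 x) :
    ∃ φ : OpenPartialHomeomorph E E, x ∈ φ.source ∧ φ.source ⊆ U ∧ (∀ y, φ y = Ψ y) ∧
      ContDiffOn ℝ ∞ φ φ.source ∧ ContDiffOn ℝ ∞ φ.symm φ.target := by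
  have : CompleteSpace E := FiniteDimensional.complete ℝ E
  have hx' : HasFDerivAt Ψ ((ContinuousLinearEquiv.refl ℝ E : E ≃L[ℝ] E) : E →L[ℝ] E) x := hx
  have hn : (∞ : WithTop ℕ∞) ≠ 0 := by simp
  let φ₀ := hΨ.contDiffAt.toOpenPartialHomeomorph Ψ hx' hn
  have hxφ₀ : x ∈ φ₀.source := hΨ.contDiffAt.mem_toOpenPartialHomeomorph_source hx' hn
  -- The source is cut down to points with invertible derivative, so that the inverse is smooth on
  -- the whole target.
  let I : Set E := fderiv ℝ Ψ ⁻¹' Set.range ((↑) : (E ≃L[ℝ] E) → E →L[ℝ] E)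
  have hI : IsOpen I := ContinuousLinearEquiv.isOpen.preimage (hΨ.continuous_fderiv hn)
  have hxI : x ∈ I := ⟨ContinuousLinearEquiv.refl ℝ E, hx'.fderiv.symm⟩
  obtain ⟨U', hU'U, hU', hxU'⟩ := mem_nhds_iff.mp hU
  refine ⟨φ₀.restrOpen (I ∩ U') (hI.inter hU'), ⟨hxφ₀, hxI, hxU'⟩, fun y hy => hU'U hy.2.2,
    fun y => rfl, hΨ.contDiffOn, fun y hy => ContDiffAt.contDiffWithinAt ?_⟩
  have hsrc := (φ₀.restrOpen (I ∩ U') (hI.inter hU')).map_target hy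
  obtain ⟨e, he⟩ := hsrc.2.1
  refine OpenPartialHomeomorph.contDiffAt_symm (f₀' := e) _ hy ?_ hΨ.contDiffAt
  rw [he]
  exact (hΨ.differentiable hn _).hasFDerivAt

/-- The image under an injective linear map of a set which is locally the zero set of a
submersion is a submanifold. -/
theorem isSubmanifold_image_of_submersion (L : V →L[ℝ] E) (hL : Function.Injective L) {d : ℕ}
    (T : Set V)
    (hT : ∀ x ∈ T, ∃ F : V → G, ContDiff ℝ ∞ F ∧ Function.Surjective (fderiv ℝ F x) ∧
      ∀ᶠ y in 𝓝 x, y ∈ T ↔ F y = 0)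
    (hd : Module.finrank ℝ V = d + Module.finrank ℝ G) :
    IsSubmanifold d (L '' T) := by
  have hn : (∞ : WithTop ℕ∞) ≠ 0 := by simp
  rintro _ ⟨x, hxT, rfl⟩
  obtain ⟨F, hF, hsurj, hev⟩ := hT x hxT
  set F' := fderiv ℝ F x with hF'
  obtain ⟨R₀, hR₀⟩ := (L : V →ₗ[ℝ] E).exists_leftInverse_of_injective
    (LinearMap.ker_eq_bot.mpr hL)
  obtain ⟨ρ₀, hρ₀⟩ := (F' : V →ₗ[ℝ] G).exists_rightInverse_of_surjective
    (LinearMap.range_eq_top.mpr hsurj)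
  let R : E →L[ℝ] V := LinearMap.toContinuousLinearMap R₀
  let ρ : G →L[ℝ] V := LinearMap.toContinuousLinearMap ρ₀
  have hR : ∀ v, R (L v) = v := fun v => LinearMap.congr_fun hR₀ v
  have hρ : ∀ g, F' (ρ g) = g := fun g => LinearMap.congr_fun hρ₀ g
  -- The correction has zero derivative at `L x` and is chosen so that `F' (R (Ψ y)) = F (R y)`. It
  -- lies in the range of `L`, so `Ψ y ∈ L (ker F')` exactly when `y` is in that range and `F (R y)
  -- = 0`.
  let Ψ : E → E := fun y => y + L (ρ (F (R y) - F' (R y)))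
  have hΨ : ContDiff ℝ ∞ Ψ := by
    have := R.contDiff (n := ∞)
    exact contDiff_id.add (L.contDiff.comp (ρ.contDiff.comp
      ((hF.comp this).sub (F'.contDiff.comp this))))
  have hΨx : HasFDerivAt Ψ (ContinuousLinearMap.id ℝ E) (L x) := by
    have h1 : HasFDerivAt F F' (R (L x)) := by
      rw [hR]; exact (hF.differentiable hn _).hasFDerivAt
    have h2 := (h1.comp (L x) R.hasFDerivAt).sub
      ((F'.hasFDerivAt (x := R (L x))).comp (L x) R.hasFDerivAt)
    have h3 := (hasFDerivAt_id (𝕜 := ℝ) (L x)).add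
      ((L.hasFDerivAt).comp (L x) ((ρ.hasFDerivAt).comp (L x) h2))
    convert! h3 using 1
    ext v
    simp
  obtain ⟨φ, hxφ, hφU, hφ, hφ1, hφ2⟩ := exists_chart hΨ hΨx
    (U := R ⁻¹' {y | y ∈ T ↔ F y = 0}) (R.continuous.continuousAt.preimage_mem_nhds
      (by rw [hR]; exact hev))
  refine ⟨φ, (LinearMap.ker (F' : V →ₗ[ℝ] G)).map (L : V →ₗ[ℝ] E), hxφ, hφ1, hφ2,
    inferInstance, ?_, ?_⟩
  · rw [← (Submodule.equivMapOfInjective (L : V →ₗ[ℝ] E) hL _).finrank_eq]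
    have := (F' : V →ₗ[ℝ] G).finrank_range_add_finrank_ker
    rw [LinearMap.range_eq_top.mpr hsurj, finrank_top] at this
    omega
  · intro y hy
    have hyU : R y ∈ T ↔ F (R y) = 0 := hφU hy
    rw [hφ]
    have hRΨ : R (Ψ y) = R y + ρ (F (R y) - F' (R y)) := by simp [Ψ, hR]
    have hker : F' (R (Ψ y)) = F (R y) := by rw [hRΨ]; simp [hρ]
    constructor
    · rintro ⟨v, hv, rfl⟩
      rw [hR] at hyU
      refine ⟨R (Ψ (L v)), ?_, ?_⟩
      · rw [SetLike.mem_coe, LinearMap.mem_ker]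
        exact hker.trans (by rw [hR]; exact hyU.mp hv)
      · change L (R (Ψ (L v))) = Ψ (L v)
        rw [hRΨ]; simp [Ψ, hR]
    · rintro ⟨w, hw, hwy⟩
      have hwy' : L w = Ψ y := hwy
      have hw' : F' w = 0 := hw
      have h0 : F (R y) = 0 := by rw [← hker, ← hwy', hR, hw']
      refine ⟨R y, hyU.mpr h0, ?_⟩
      have : L (R (Ψ y)) = Ψ y := by rw [← hwy', hR]
      rw [hRΨ, map_add] at this
      exact add_right_cancel this

end Manifold

end HankelApprox

namespace HankelApprox

open Filter Topology

/-! ### Zero sets of complex polynomials in several variables. -/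

section MvPoly

variable {σ : Type*}

open MvPolynomial in
theorem totalDegree_pderiv_lt {p : MvPolynomial σ ℂ} {i : σ} (h : pderiv i p ≠ 0) :
    (pderiv i p).totalDegree < p.totalDegree := by
  have hlt : ∀ m ∈ (pderiv i p).support, (m.sum fun _ e => e) + 1 ≤ p.totalDegree := by
    intro m hm
    rw [mem_support_iff, coeff_pderiv] at hm
    have := le_totalDegree (mem_support_iff.mpr (left_ne_zero_of_mul hm))
    rwa [Finsupp.sum_add_index' (fun _ => rfl) (fun _ _ _ => rfl),
      Finsupp.sum_single_index rfl] at this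
  obtain ⟨m, hm⟩ := support_nonempty.mpr h
  have hpos := hlt m hm
  rw [totalDegree, Finset.sup_lt_iff (by simpa using by omega)]
  exact fun m hm => hlt m hm

-- In characteristic zero, differentiating a nonconstant monomial in one of its variables multiplies
-- its coefficient by a nonzero integer.
open MvPolynomial in
theorem exists_pderiv_ne_zero {p : MvPolynomial σ ℂ} (h : p.totalDegree ≠ 0) :
    ∃ i, pderiv i p ≠ 0 := by
  contrapose! h
  rw [totalDegree_eq_zero_iff]
  intro m hm i
  by_contra hmi
  have hc : coeff (m - Finsupp.single i 1) (pderiv i p) = 0 := by rw [h i, coeff_zero]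
  rw [coeff_pderiv, tsub_add_cancel_of_le (by simpa using Nat.one_le_iff_ne_zero.mpr hmi)] at hc
  refine (mul_ne_zero (mem_support_iff.mp hm) ?_) hc
  exact Nat.cast_add_one_ne_zero _

open MvPolynomial in
/-- The zero set of a nonzero polynomial is covered by finitely many smooth hypersurfaces. -/
theorem exists_hypersurface_cover [Fintype σ] {p : MvPolynomial σ ℂ} (hp : p ≠ 0) :
    ∃ T : Finset (MvPolynomial σ ℂ × σ), ∀ x : σ → ℂ, eval x p = 0 →
      ∃ g ∈ T, eval x g.1 = 0 ∧ eval x (pderiv g.2 g.1) ≠ 0 := by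
  classical
  induction hn : p.totalDegree using Nat.strong_induction_on generalizing p with
  | _ n ih =>
    by_cases hd : p.totalDegree = 0
    · refine ⟨∅, fun x hx => absurd hx ?_⟩
      rw [totalDegree_eq_zero_iff_eq_C] at hd
      rw [hd, eval_C]
      rintro h0
      rw [h0, C_0] at hd
      exact hp hd
    · obtain ⟨i, hi⟩ := exists_pderiv_ne_zero hd
      obtain ⟨T, hT⟩ := ih _ (hn ▸ totalDegree_pderiv_lt hi) hi rfl
      refine ⟨insert (p, i) T, fun x hx => ?_⟩
      -- A singular point for direction `i` is a zero of `pderiv i p`, which is nonzero of smaller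
      -- degree.
      by_cases hxi : eval x (pderiv i p) = 0
      · obtain ⟨g, hg, h⟩ := hT x hxi
        exact ⟨g, Finset.mem_insert_of_mem hg, h⟩
      · exact ⟨(p, i), Finset.mem_insert_self _ _, hx, hxi⟩

variable [Fintype σ]

theorem contDiff_eval_mvPolynomial (p : MvPolynomial σ ℂ) :
    ContDiff ℂ ω (fun x : σ → ℂ => MvPolynomial.eval x p) :=
  (AnalyticOnNhd.eval_mvPolynomial p).contDiff

theorem fderiv_eval_mvPolynomial_single [DecidableEq σ] (p : MvPolynomial σ ℂ) (x : σ → ℂ)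
    (i : σ) :
    fderiv ℂ (fun x : σ → ℂ => MvPolynomial.eval x p) x (Pi.single i 1) =
      MvPolynomial.eval x (MvPolynomial.pderiv i p) := by
  have hdiff (q : MvPolynomial σ ℂ) :
      DifferentiableAt ℂ (fun x : σ → ℂ => MvPolynomial.eval x q) x :=
    (contDiff_eval_mvPolynomial q).differentiable (by simp) x
  induction p using MvPolynomial.induction_on with
  | C a => simp
  | add p q hp hq =>
    simp only [map_add]
    rw [fderiv_fun_add (hdiff p) (hdiff q)]
    simp [hp, hq]
  | mul_X p j hp =>
    have hX : fderiv ℂ (fun x : σ → ℂ => x j) x = ContinuousLinearMap.proj j :=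
      (ContinuousLinearMap.proj (R := ℂ) (φ := fun _ : σ => ℂ) j).fderiv
    have hXd : DifferentiableAt ℂ (fun x : σ → ℂ => x j) x :=
      (ContinuousLinearMap.proj (R := ℂ) (φ := fun _ : σ => ℂ) j).differentiableAt
    simp only [map_mul, MvPolynomial.eval_X, MvPolynomial.pderiv_mul]
    rw [fderiv_fun_mul (hdiff p) hXd, hX]
    by_cases h : j = i
    · subst h
      simp [hp]
      ring
    · simp [hp, h, MvPolynomial.pderiv_X]
      ring

theorem fderiv_eval_mvPolynomial_surjective {p : MvPolynomial σ ℂ} {x : σ → ℂ} {i : σ}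
    (h : MvPolynomial.eval x (MvPolynomial.pderiv i p) ≠ 0) :
    Function.Surjective (fderiv ℝ (fun x : σ → ℂ => MvPolynomial.eval x p) x) := by
  classical
  intro z
  have hd : DifferentiableAt ℂ (fun x : σ → ℂ => MvPolynomial.eval x p) x :=
    (contDiff_eval_mvPolynomial p).differentiable (by simp) x
  refine ⟨(z / MvPolynomial.eval x (MvPolynomial.pderiv i p)) • Pi.single i 1, ?_⟩
  rw [hd.fderiv_restrictScalars ℝ, ContinuousLinearMap.coe_restrictScalars', map_smul,
    fderiv_eval_mvPolynomial_single, smul_eq_mul, div_mul_cancel₀ _ h]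

end MvPoly

end HankelApprox

namespace HankelApprox

open Polynomial

/-! ### Moment functionals and the normalised recursion polynomial. -/

section Pairing

variable {R : Type*} [CommRing R]

/-- The linear functional on polynomials with moments `a k`. -/
noncomputable def pairing (a : ℕ → R) : R[X] →ₗ[R] R :=
  Polynomial.lsum fun k => LinearMap.toSpanSingleton R R (a k)

theorem pairing_monomial (a : ℕ → R) (k : ℕ) (c : R) : pairing a (monomial k c) = c * a k := by
  simp [pairing, Polynomial.lsum_apply, Polynomial.sum_monomial_index]

theorem pairing_X_pow_mul_eq_shift (a : ℕ → R) (k : ℕ) (q : R[X]) :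
    pairing a (X ^ k * q) = pairing (fun l => a (k + l)) q := by
  induction q using Polynomial.induction_on' with
  | add p q hp hq => rw [mul_add, map_add, map_add, hp, hq]
  | monomial n c =>
    rw [X_pow_mul_monomial, pairing_monomial, pairing_monomial, add_comm]

theorem pairing_eq_sum (a : ℕ → R) {q : R[X]} {m : ℕ} (h : q.natDegree ≤ m) :
    pairing a q = ∑ l ∈ Finset.range (m + 1), q.coeff l * a l := by
  conv_lhs => rw [q.as_sum_range' (m + 1) (by omega)]
  simp [pairing_monomial]

theorem pairing_X_pow_mul (a : ℕ → R) (k : ℕ) {q : R[X]} {m : ℕ} (h : q.natDegree ≤ m) :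
    pairing a (X ^ k * q) = ∑ l ∈ Finset.range (m + 1), q.coeff l * a (k + l) := by
  rw [pairing_X_pow_mul_eq_shift, pairing_eq_sum _ h]

theorem pairing_X_pow_mul_mul (a : ℕ → R) (i : ℕ) {p : R[X]} (s : R[X]) {m : ℕ}
    (h : p.natDegree ≤ m) :
    pairing a (X ^ i * (p * s)) =
      ∑ j ∈ Finset.range (m + 1), p.coeff j * pairing a (X ^ (i + j) * s) := by
  conv_lhs => rw [p.as_sum_range' (m + 1) (by omega), Finset.sum_mul, Finset.mul_sum, map_sum]
  refine Finset.sum_congr rfl fun j _ => ?_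
  rw [← C_mul_X_pow_eq_monomial, show X ^ i * (C (p.coeff j) * X ^ j * s) =
    (p.coeff j) • (X ^ (i + j) * s) by rw [smul_eq_C_mul]; ring, map_smul, smul_eq_mul]

theorem pairing_X_pow_mul_C_mul (a : ℕ → R) (i : ℕ) (c : R) (s : R[X]) :
    pairing a (X ^ i * (C c * s)) = c * pairing a (X ^ i * s) := by
  rw [show X ^ i * (C c * s) = c • (X ^ i * s) by rw [smul_eq_C_mul]; ring, map_smul, smul_eq_mul]

/-- If `p` and `s` annihilate enough moments, then `p` annihilates one more. -/
theorem pairing_X_pow_mul_eq_zero [IsDomain R] (a : ℕ → R) {p s : R[X]} {i e : ℕ} (hs : s ≠ 0)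
    (hi : s.natDegree ≤ i) (he : p.natDegree ≤ e)
    (h1 : ∀ j ≤ e, pairing a (X ^ (i - s.natDegree + j) * s) = 0)
    (h2 : ∀ k < i, pairing a (X ^ k * p) = 0) :
    pairing a (X ^ i * p) = 0 := by
  -- The pairing with `X ^ (i - deg s) * p * s` is expanded twice. Along the coefficients of `p`
  -- everything vanishes; along those of `s` only the leading one survives, times the wanted
  -- pairing.
  have e1 := pairing_X_pow_mul_mul a (i - s.natDegree) s he
  have e2 := pairing_X_pow_mul_mul a (i - s.natDegree) p (le_refl s.natDegree)
  rw [Finset.sum_eq_zero fun j hj => by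
    rw [h1 j (by simpa [Nat.lt_succ_iff] using hj), mul_zero]] at e1
  rw [mul_comm s p, e1, Finset.sum_range_succ, Finset.sum_eq_zero fun j hj => by
    rw [h2 _ (by have := Finset.mem_range.mp hj; omega), mul_zero], zero_add,
    Nat.sub_add_cancel hi, coeff_natDegree] at e2
  exact (mul_eq_zero.mp e2.symm).resolve_left (leadingCoeff_ne_zero.mpr hs)

/-- The Hankel matrix of order `s` of a sequence. -/
def hankelCorner (s : ℕ) (a : ℕ → R) : Matrix (Fin s) (Fin s) R :=
  Matrix.of fun i j => a (i + j)

/-- The lower coefficients of the recursion polynomial. -/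
noncomputable def tailCoeff (s : ℕ) (a : ℕ → R) : Fin s → R :=
  -((hankelCorner s a).adjugate.mulVec fun i => a (i + s))

/-- The recursion of order `s` satisfied by the first `2 s` terms of a sequence, normalised by
the determinant of the corner. -/
noncomputable def recPoly (s : ℕ) (a : ℕ → R) : R[X] :=
  C (hankelCorner s a).det * X ^ s + ∑ l : Fin s, C (tailCoeff s a l) * X ^ (l : ℕ)

theorem natDegree_recPoly_le (s : ℕ) (a : ℕ → R) : (recPoly s a).natDegree ≤ s := by
  refine natDegree_add_le_of_degree_le (natDegree_C_mul_X_pow_le _ _) ?_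
  exact natDegree_sum_le_of_forall_le _ _ fun l _ =>
    (natDegree_C_mul_X_pow_le _ _).trans l.2.le

theorem coeff_recPoly_self (s : ℕ) (a : ℕ → R) :
    (recPoly s a).coeff s = (hankelCorner s a).det := by
  simp only [recPoly, coeff_add, finsetSum_coeff, coeff_C_mul_X_pow]
  simp only [if_true]
  rw [Finset.sum_eq_zero, add_zero]
  exact fun l _ => if_neg (by have := l.2; omega)

theorem coeff_recPoly_of_lt (s : ℕ) (a : ℕ → R) (l : Fin s) :
    (recPoly s a).coeff l = tailCoeff s a l := by
  simp only [recPoly, coeff_add, finsetSum_coeff, coeff_C_mul_X_pow]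
  rw [if_neg (by have := l.2; omega), zero_add, Finset.sum_eq_single l]
  · simp
  · exact fun b _ hb => if_neg fun h => hb (Fin.ext h.symm)
  · simp

theorem pairing_X_pow_mul_recPoly (s : ℕ) (a b : ℕ → R) (k : ℕ) :
    pairing b (X ^ k * recPoly s a) =
      (hankelCorner s a).det * b (k + s) + ∑ l : Fin s, tailCoeff s a l * b (k + l) := by
  rw [pairing_X_pow_mul b k (natDegree_recPoly_le s a), Finset.sum_range_succ,
    coeff_recPoly_self, add_comm, Finset.sum_range]
  simp only [coeff_recPoly_of_lt]

/-- This is Cramer's rule: the adjugate solves the first `s` equations up to the factor `det`. -/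
theorem pairing_recPoly_of_lt {s : ℕ} (a : ℕ → R) {k : ℕ} (hk : k < s) :
    pairing a (X ^ k * recPoly s a) = 0 := by
  rw [pairing_X_pow_mul_recPoly]
  have h : (hankelCorner s a).mulVec (tailCoeff s a) ⟨k, hk⟩ =
      -((hankelCorner s a).det * a (k + s)) := by
    rw [tailCoeff, Matrix.mulVec_neg, Matrix.mulVec_mulVec, Matrix.mul_adjugate,
      Matrix.smul_mulVec, Matrix.one_mulVec]
    simp
  rw [Matrix.mulVec, dotProduct] at h
  rw [← neg_eq_iff_add_eq_zero, ← h]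
  exact Finset.sum_congr rfl fun l _ => mul_comm _ _

/-- A recursion of order `s` satisfied by the first `2 s` terms is proportional to
`recPoly s a`. -/
theorem C_det_mul_eq {s : ℕ} (a : ℕ → R) {q : R[X]} (hq : q.natDegree ≤ s)
    (h : ∀ k < s, pairing a (X ^ k * q) = 0) :
    C (hankelCorner s a).det * q = C (q.coeff s) * recPoly s a := by
  have h1 : (hankelCorner s a).mulVec (fun l : Fin s => q.coeff l) =
      -(q.coeff s • fun i : Fin s => a (i + s)) := by
    ext i
    have := h i i.2
    rw [pairing_X_pow_mul a i hq, Finset.sum_range_succ, Finset.sum_range] at this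
    rw [Pi.neg_apply, Pi.smul_apply, smul_eq_mul, ← eq_neg_of_add_eq_zero_left this]
    simp only [hankelCorner, Matrix.mulVec, dotProduct, Matrix.of_apply, mul_comm]
  have h2 : (hankelCorner s a).det • (fun l : Fin s => q.coeff l) =
      q.coeff s • tailCoeff s a := by
    have := congrArg (hankelCorner s a).adjugate.mulVec h1
    rwa [Matrix.mulVec_mulVec, Matrix.adjugate_mul, Matrix.smul_mulVec, Matrix.one_mulVec,
      Matrix.mulVec_neg, Matrix.mulVec_smul, ← smul_neg] at this
  ext k
  rw [coeff_C_mul, coeff_C_mul]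
  rcases lt_trichotomy k s with hk | rfl | hk
  · have := congrFun h2 ⟨k, hk⟩
    rw [show k = ((⟨k, hk⟩ : Fin s) : ℕ) from rfl, coeff_recPoly_of_lt]
    exact this
  · rw [coeff_recPoly_self, mul_comm]
  · rw [coeff_eq_zero_of_natDegree_lt (by omega),
      coeff_eq_zero_of_natDegree_lt ((natDegree_recPoly_le s a).trans_lt hk)]
    simp

theorem hankelCorner_congr {T : Type*} {s : ℕ} {a b : ℕ → T} (h : ∀ k, k + 1 < 2 * s → a k = b k) :
    hankelCorner s a = hankelCorner s b := by
  ext i j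
  exact h _ (by omega)

/-- Changing later terms leaves the recursion polynomial fixed; this makes the equations of a
stratum affine in those terms. -/
theorem recPoly_congr {s : ℕ} {a b : ℕ → R} (h : ∀ k < 2 * s, a k = b k) :
    recPoly s a = recPoly s b := by
  have h1 : hankelCorner s a = hankelCorner s b := hankelCorner_congr fun k hk => h k (by omega)
  have h2 : (fun i : Fin s => a (i + s)) = fun i : Fin s => b (i + s) :=
    funext fun i => h _ (by omega)
  rw [recPoly, recPoly, tailCoeff, tailCoeff, h1, h2]

/-- The adjugate avoids division, so the construction can be done once over indeterminates and then
specialised. -/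
theorem recPoly_map {S : Type*} [CommRing S] (φ : R →+* S) (s : ℕ) (a : ℕ → R) :
    recPoly s (fun k => φ (a k)) = (recPoly s a).map φ := by
  have h1 : hankelCorner s (fun k => φ (a k)) = φ.mapMatrix (hankelCorner s a) := rfl
  have h2 : ∀ l, tailCoeff s (fun k => φ (a k)) l = φ (tailCoeff s a l) := by
    intro l
    rw [tailCoeff, tailCoeff, h1, ← RingHom.map_adjugate]
    simp [Matrix.mulVec, dotProduct]
  rw [recPoly, recPoly, h1, ← RingHom.map_det]
  simp [h2, Polynomial.map_sum]

/-- A polynomial expression in the coefficients of `q` which vanishes unless `q` has degree `r`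
and only simple nonzero roots. -/
noncomputable def genericity (r : ℕ) (q : R[X]) : R :=
  q.coeff r * (q.coeff 0 * resultant q (derivative q) r (r - 1))

/-- The resultant uses fixed formal degrees, so it commutes with specialisation even when the degree
of `q` drops. -/
theorem genericity_map {S : Type*} [CommRing S] (φ : R →+* S) (r : ℕ) (q : R[X]) :
    genericity r (q.map φ) = φ (genericity r q) := by
  rw [genericity, genericity, derivative_map, resultant_map_map, coeff_map, coeff_map, map_mul,
    map_mul]

end Pairing

/-! ### Simple nonzero roots and the resultant. -/

section Roots

theorem exists_eq_prod_of_nodup_roots {q : ℂ[X]} {r : ℕ} (hd : q.natDegree = r)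
    (hn : q.roots.Nodup) :
    ∃ z : Fin r → ℂ, Function.Injective z ∧ (∀ i, z i ∈ q.roots) ∧
      q = C q.leadingCoeff * ∏ i, (X - C (z i)) := by
  have hs : q.Splits := IsAlgClosed.splits q
  have hcard : q.roots.toFinset.card = r := by
    rw [Multiset.toFinset_card_of_nodup hn, ← hd, hs.natDegree_eq_card_roots]
  let e := Finset.equivFinOfCardEq hcard
  refine ⟨fun i => (e.symm i : ℂ), Subtype.val_injective.comp e.symm.injective,
    fun i => Multiset.mem_toFinset.mp (e.symm i).2, ?_⟩
  conv_lhs => rw [hs.eq_prod_roots]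
  congr 1
  rw [Equiv.prod_comp e.symm (fun x : q.roots.toFinset => X - C (x : ℂ)),
    Finset.prod_coe_sort q.roots.toFinset fun x => X - C x, Finset.prod,
    Multiset.toFinset_val, hn.dedup]

theorem exists_eq_prod_of_genericity_ne_zero {q : ℂ[X]} {r : ℕ} (hd : q.natDegree ≤ r)
    (h : genericity r q ≠ 0) :
    ∃ z : Fin r → ℂ, Function.Injective z ∧ (∀ i, z i ≠ 0) ∧
      q = C (q.coeff r) * ∏ i, (X - C (z i)) := by
  have h1 : q.coeff r ≠ 0 := left_ne_zero_of_mul h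
  have h2 : q.coeff 0 ≠ 0 := left_ne_zero_of_mul (right_ne_zero_of_mul h)
  have h3 := right_ne_zero_of_mul (right_ne_zero_of_mul h)
  have hd' : q.natDegree = r := le_antisymm hd (le_natDegree_of_ne_zero h1)
  have hq0 : q ≠ 0 := by rintro rfl; simp at h1
  have hcop : q.Separable := by
    by_contra hc
    refine h3 ?_
    have := resultant_eq_zero_iff.mpr ⟨Or.inl hq0, hc⟩
    rwa [natDegree_derivative, hd'] at this
  obtain ⟨z, hz, hroot, heq⟩ := exists_eq_prod_of_nodup_roots hd' (nodup_roots hcop)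
  refine ⟨z, hz, fun i h0 => h2 ?_, ?_⟩
  · have := (mem_roots hq0).mp (hroot i)
    rwa [h0, IsRoot, ← coeff_zero_eq_eval_zero] at this
  · rwa [leadingCoeff, hd'] at heq

theorem natDegree_prod_X_sub_C {r : ℕ} (z : Fin r → ℂ) :
    (∏ i, (X - C (z i))).natDegree = r := by
  simp [natDegree_prod_of_monic, monic_X_sub_C]

theorem monic_prod_X_sub_C {r : ℕ} (z : Fin r → ℂ) : (∏ i, (X - C (z i))).Monic :=
  monic_prod_of_monic _ _ fun _ _ => monic_X_sub_C _

theorem coeff_prod_X_sub_C {r : ℕ} (z : Fin r → ℂ) : (∏ i, (X - C (z i))).coeff r = 1 := by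
  have := (monic_prod_X_sub_C z).coeff_natDegree
  rwa [natDegree_prod_X_sub_C] at this

theorem genericity_prod_ne_zero {r : ℕ} {z : Fin r → ℂ} (hz : Function.Injective z)
    (h0 : ∀ i, z i ≠ 0) {c : ℂ} (hc : c ≠ 0) :
    genericity r (C c * ∏ i, (X - C (z i))) ≠ 0 := by
  set q := C c * ∏ i, (X - C (z i)) with hq
  have hd : q.natDegree = r := by
    rw [hq, natDegree_C_mul hc, natDegree_prod_X_sub_C]
  have hsep : q.Separable :=
    (separable_prod_X_sub_C_iff.mpr hz).unit_mul (isUnit_C.mpr hc.isUnit)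
  refine mul_ne_zero ?_ (mul_ne_zero ?_ ?_)
  · rw [hq, coeff_C_mul, coeff_prod_X_sub_C, mul_one]
    exact hc
  · rw [coeff_zero_eq_eval_zero, hq, eval_mul, eval_C, eval_prod]
    refine mul_ne_zero hc (Finset.prod_ne_zero_iff.mpr fun i _ => ?_)
    simpa using h0 i
  · intro h
    have h' : resultant q (derivative q) = 0 := by rwa [natDegree_derivative, hd]
    exact (resultant_eq_zero_iff.mp h').2 hsep

end Roots

end HankelApprox

namespace HankelApprox

open Polynomial

/-! ### Kernels of Hankel matrices and low-rank recursions. -/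

section Kernel

/-- The polynomials of degree less than `N` whose coefficient vectors lie in the kernel of the
Hankel matrix of order `N` of a sequence. -/
noncomputable def apolar (N : ℕ) (a : ℕ → ℂ) : Submodule ℂ ℂ[X] :=
  degreeLT ℂ N ⊓ ⨅ i : Fin N, LinearMap.ker (pairing a ∘ₗ LinearMap.mulLeft ℂ (X ^ (i : ℕ)))

theorem mem_apolar {N : ℕ} {a : ℕ → ℂ} {p : ℂ[X]} :
    p ∈ apolar N a ↔ p ∈ degreeLT ℂ N ∧ ∀ i < N, pairing a (X ^ i * p) = 0 := by
  simp [apolar, Submodule.mem_iInf, Fin.forall_iff]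

theorem natDegree_lt_of_mem_degreeLT {N : ℕ} (hN : 0 < N) {p : ℂ[X]} (h : p ∈ degreeLT ℂ N) :
    p.natDegree < N := by
  rcases eq_or_ne p 0 with rfl | hp
  · simpa
  · exact (natDegree_lt_iff_degree_lt hp).mpr (mem_degreeLT.mp h)

theorem pairing_degreeLTEquiv_symm {N : ℕ} (a : ℕ → ℂ) (v : Fin N → ℂ) (i : ℕ) :
    pairing a (X ^ i * ((degreeLTEquiv ℂ N).symm v : ℂ[X])) = ∑ l : Fin N, v l * a (i + l) := by
  rw [pairing_X_pow_mul_eq_shift]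
  change pairing _ (∑ l : Fin N, monomial (l : ℕ) (v l)) = _
  simp [map_sum, pairing_monomial]

theorem finrank_apolar (N : ℕ) (a : ℕ → ℂ) :
    Module.finrank ℂ (apolar N a) + (hankelCorner N a).rank = N := by
  let e := (degreeLTEquiv ℂ N).symm
  let φ : (Fin N → ℂ) →ₗ[ℂ] ℂ[X] := (degreeLT ℂ N).subtype ∘ₗ e.toLinearMap
  have hφ : Function.Injective φ := Subtype.val_injective.comp e.injective
  have h : apolar N a = (LinearMap.ker (hankelCorner N a).mulVecLin).map φ := by
    ext p
    rw [mem_apolar, Submodule.mem_map]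
    have key : ∀ v : Fin N → ℂ, v ∈ LinearMap.ker (hankelCorner N a).mulVecLin ↔
        ∀ i < N, pairing a (X ^ i * φ v) = 0 := by
      intro v
      have hpv (i : ℕ) : pairing a (X ^ i * φ v) = ∑ l : Fin N, v l * a (i + l) :=
        pairing_degreeLTEquiv_symm a v i
      rw [LinearMap.mem_ker, Matrix.mulVecLin_apply, funext_iff, Fin.forall_iff]
      refine forall₂_congr fun i hi => ?_
      rw [hpv]
      simp only [hankelCorner, Matrix.mulVec, dotProduct, Matrix.of_apply, mul_comm,
        Pi.zero_apply]
    constructor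
    · rintro ⟨hp, h⟩
      obtain ⟨v, hv⟩ := e.surjective ⟨p, hp⟩
      have hvp : φ v = p := congrArg Subtype.val hv
      exact ⟨v, (key v).mpr (by rwa [hvp]), hvp⟩
    · rintro ⟨v, hv, rfl⟩
      exact ⟨(e v).2, (key v).mp hv⟩
  rw [h, ← (Submodule.equivMapOfInjective φ hφ _).finrank_eq, Matrix.rank, add_comm]
  simpa using (hankelCorner N a).mulVecLin.finrank_range_add_finrank_ker

/-- Extremal degrees in a finite-dimensional space of polynomials. -/
theorem exists_extremal_natDegree {N d : ℕ} (K : Submodule ℂ ℂ[X]) (hN : 0 < N)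
    (hK : K ≤ degreeLT ℂ N) (hd : d < Module.finrank ℂ K) :
    ∃ p ∈ K, ∃ s ∈ K, p ≠ 0 ∧ s ≠ 0 ∧ p.natDegree + d ≤ s.natDegree ∧
      ∀ q ∈ K, q ≠ 0 → p.natDegree ≤ q.natDegree := by
  let D : Set ℕ := {n | ∃ p ∈ K, p ≠ 0 ∧ p.natDegree = n}
  have hKbot : K ≠ ⊥ := by rintro rfl; simp at hd
  obtain ⟨p₀, hp₀, hp₀'⟩ := (Submodule.ne_bot_iff K).mp hKbot
  have hD : D.Nonempty := ⟨_, p₀, hp₀, hp₀', rfl⟩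
  have hDb : BddAbove D := ⟨N, by
    rintro _ ⟨p, hp, -, rfl⟩
    exact (natDegree_lt_of_mem_degreeLT hN (hK hp)).le⟩
  obtain ⟨p, hp, hp0, hpd⟩ := Nat.sInf_mem hD
  obtain ⟨s, hs, hs0, hsd⟩ := Nat.sSup_mem hD hDb
  have hmin : ∀ q ∈ K, q ≠ 0 → p.natDegree ≤ q.natDegree := fun q hq hq0 =>
    hpd.le.trans (Nat.sInf_le ⟨q, hq, hq0, rfl⟩)
  have hmax : ∀ q ∈ K, q ≠ 0 → q.natDegree ≤ s.natDegree := fun q hq hq0 =>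
    (le_csSup hDb ⟨q, hq, hq0, rfl⟩).trans hsd.ge
  refine ⟨p, hp, s, hs, hp0, hs0, ?_, hmin⟩
  -- Leading coefficients lie between the extremal degrees, so reading the coefficients in this
  -- window is injective, and the window has at least dim K places.
  let ψ : K →ₗ[ℂ] (Fin (s.natDegree - p.natDegree + 1) → ℂ) :=
    LinearMap.pi fun j => lcoeff ℂ (p.natDegree + j) ∘ₗ K.subtype
  have hψ : Function.Injective ψ := by
    rw [← LinearMap.ker_eq_bot, LinearMap.ker_eq_bot']
    rintro ⟨q, hq⟩ h
    by_contra hq0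
    have hq0' : q ≠ 0 := fun h => hq0 (Subtype.ext h)
    have h1 := hmin q hq hq0'
    have h2 := hmax q hq hq0'
    have h3 := congrFun h ⟨q.natDegree - p.natDegree, by omega⟩
    have h4 : q.coeff (p.natDegree + (q.natDegree - p.natDegree)) = 0 := h3
    rw [Nat.add_sub_cancel' h1, coeff_natDegree, leadingCoeff_eq_zero] at h4
    exact hq0' h4
  have h1 := LinearMap.finrank_le_finrank_of_injective hψ
  rw [Module.finrank_fin_fun] at h1
  have h2 := hmin s hs hs0
  omega

/-- A Hankel matrix of rank at most `r < N` is described by a recursion of some order `m ≤ r`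
with nonsingular corner, which holds up to the last `r - m` antidiagonals. -/
theorem exists_recursion_of_rank_le {N r : ℕ} (hr : r < N) {a : ℕ → ℂ}
    (h : (hankelCorner N a).rank ≤ r) :
    ∃ p : ℂ[X], p.Monic ∧ p.natDegree ≤ r ∧ (hankelCorner p.natDegree a).det ≠ 0 ∧
      ∀ i, i + r < 2 * N - 1 → pairing a (X ^ i * p) = 0 := by
  have hrank := finrank_apolar N a
  obtain ⟨p, hp, s, hs, hp0, hs0, hps, hmin⟩ :=
    exists_extremal_natDegree (d := N - r - 1) (apolar N a) (by omega) inf_le_left (by omega)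
  obtain ⟨hpN, hp⟩ := mem_apolar.mp hp
  obtain ⟨hsN, hs⟩ := mem_apolar.mp hs
  have hpN := natDegree_lt_of_mem_degreeLT (by omega) hpN
  have hsN := natDegree_lt_of_mem_degreeLT (by omega) hsN
  -- For i ≥ N, `s` is used: deg p - deg s ≤ r + 1 - N and i + r < 2N - 1 keep every shift of `s`
  -- below `N`.
  have hext : ∀ i, i + r < 2 * N - 1 → pairing a (X ^ i * p) = 0 := by
    intro i
    induction i using Nat.strong_induction_on with
    | _ i ih =>
      intro hi
      by_cases hiN : i < N
      · exact hp i hiN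
      · exact pairing_X_pow_mul_eq_zero a hs0 (by omega) le_rfl
          (fun j hj => hs _ (by omega)) fun k hk => ih k hk (by omega)
  -- A kernel vector of the corner is a polynomial of degree below deg p; `p` propagates its
  -- vanishing pairings to all i < N, contradicting minimality.
  have hdet : (hankelCorner p.natDegree a).det ≠ 0 := by
    intro hdet
    obtain ⟨v, hv0, hv⟩ := Matrix.exists_mulVec_eq_zero_iff.mpr hdet
    set e := (degreeLTEquiv ℂ p.natDegree).symm with he
    set q : ℂ[X] := (e v : ℂ[X]) with hq
    have hqd : q.degree < p.natDegree := mem_degreeLT.mp (e v).2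
    have hq0 : q ≠ 0 := by
      intro h0
      exact hv0 (e.map_eq_zero_iff.mp (Subtype.ext h0))
    have hqn : q.natDegree < p.natDegree := (natDegree_lt_iff_degree_lt hq0).mpr hqd
    have hqi : ∀ i < N, pairing a (X ^ i * q) = 0 := by
      intro i
      induction i using Nat.strong_induction_on with
      | _ i ih =>
        intro hi
        by_cases him : i < p.natDegree
        · rw [hq, he, pairing_degreeLTEquiv_symm]
          have := congrFun hv ⟨i, him⟩
          simpa only [hankelCorner, Matrix.mulVec, dotProduct, Matrix.of_apply, mul_comm,
            Pi.zero_apply] using this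
        · exact pairing_X_pow_mul_eq_zero a hp0 (by omega) (Nat.le_sub_one_of_lt hqn)
            (fun j hj => hp _ (by omega)) fun k hk => ih k hk (by omega)
    have := hmin q (mem_apolar.mpr ⟨mem_degreeLT.mpr (hqd.trans_le
      (by exact_mod_cast hpN.le)), hqi⟩) hq0
    omega
  refine ⟨C p.leadingCoeff⁻¹ * p, ?_, ?_, ?_, fun i hi => ?_⟩
  · rw [mul_comm]
    exact monic_mul_leadingCoeff_inv hp0
  · rw [natDegree_C_mul (inv_ne_zero (leadingCoeff_ne_zero.mpr hp0))]
    omega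
  · rwa [natDegree_C_mul (inv_ne_zero (leadingCoeff_ne_zero.mpr hp0))]
  · rw [pairing_X_pow_mul_C_mul, hext i hi, mul_zero]

end Kernel

/-! ### Sums of exponentials. -/

section PowerSums

variable {r : ℕ}

/-- The sequence of power sums `∑ i, c i * z i ^ k`. -/
noncomputable def powerSum (z c : Fin r → ℂ) (k : ℕ) : ℂ := ∑ i, c i * z i ^ k

theorem pairing_powerSum (z c : Fin r → ℂ) (q : ℂ[X]) :
    pairing (powerSum z c) q = ∑ i, c i * q.eval (z i) := by
  induction q using Polynomial.induction_on' with
  | add p q hp hq => simp only [map_add, hp, hq, eval_add, mul_add, Finset.sum_add_distrib]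
  | monomial n b =>
    rw [pairing_monomial, powerSum, Finset.mul_sum]
    simp only [eval_monomial]
    exact Finset.sum_congr rfl fun i _ => by ring

theorem pairing_powerSum_prod (z c : Fin r → ℂ) (k : ℕ) :
    pairing (powerSum z c) (X ^ k * ∏ i, (X - C (z i))) = 0 := by
  rw [pairing_powerSum]
  refine Finset.sum_eq_zero fun i _ => ?_
  rw [eval_mul, eval_prod, Finset.prod_eq_zero (Finset.mem_univ i) (by simp), mul_zero, mul_zero]

theorem hankelCorner_powerSum (z c : Fin r → ℂ) :
    hankelCorner r (powerSum z c) =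
      (Matrix.vandermonde z).transpose * Matrix.diagonal c * Matrix.vandermonde z := by
  ext j l
  rw [Matrix.mul_apply]
  simp only [hankelCorner, powerSum, Matrix.of_apply, Matrix.mul_diagonal,
    Matrix.transpose_apply, Matrix.vandermonde_apply, pow_add]
  exact Finset.sum_congr rfl fun i _ => by ring

theorem det_hankelCorner_powerSum_ne_zero_iff {z c : Fin r → ℂ} (hz : Function.Injective z) :
    (hankelCorner r (powerSum z c)).det ≠ 0 ↔ ∀ i, c i ≠ 0 := by
  have hv := Matrix.det_vandermonde_ne_zero_iff.mpr hz
  rw [hankelCorner_powerSum, Matrix.det_mul, Matrix.det_mul, Matrix.det_transpose,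
    Matrix.det_diagonal]
  simp [hv, Finset.prod_eq_zero_iff]

theorem rank_hankelCorner_powerSum_le (N : ℕ) (z c : Fin r → ℂ) :
    (hankelCorner N (powerSum z c)).rank ≤ r := by
  have h : hankelCorner N (powerSum z c) =
      (Matrix.of fun (j : Fin N) (i : Fin r) => c i * z i ^ (j : ℕ)) *
        Matrix.of fun (i : Fin r) (l : Fin N) => z i ^ (l : ℕ) := by
    ext j l
    simp only [hankelCorner, powerSum, Matrix.of_apply, Matrix.mul_apply, pow_add]
    exact Finset.sum_congr rfl fun i _ => by ring
  rw [h]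
  refine (Matrix.rank_mul_le_left _ _).trans ((Matrix.rank_le_card_width _).trans ?_)
  simp

/-- A sequence satisfying a recursion with simple roots is a combination of their powers. -/
theorem exists_powerSum_of_recursion {z : Fin r → ℂ} (hz : Function.Injective z) (a : ℕ → ℂ) :
    ∃ c : Fin r → ℂ, ∀ B : ℕ, (∀ k, k + r < B → pairing a (X ^ k * ∏ i, (X - C (z i))) = 0) →
      ∀ k < B, a k = powerSum z c k := by
  have hv : IsUnit (Matrix.vandermonde z).transpose := by
    rw [Matrix.isUnit_iff_isUnit_det, Matrix.det_transpose]
    exact (Matrix.det_vandermonde_ne_zero_iff.mpr hz).isUnit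
  -- The Vandermonde system fits the first `r` terms, independently of `B`; the monic recursion
  -- determines the rest.
  obtain ⟨c, hc⟩ := Matrix.mulVec_surjective_iff_isUnit.mpr hv fun k : Fin r => a k
  refine ⟨c, fun B hB k => ?_⟩
  induction k using Nat.strong_induction_on with
  | _ k ih =>
    intro hk
    by_cases hkr : k < r
    · have := congrFun hc ⟨k, hkr⟩
      rw [← show _ = a k from this]
      simp only [Matrix.mulVec, dotProduct, Matrix.transpose_apply, Matrix.vandermonde_apply,
        powerSum]
      exact Finset.sum_congr rfl fun i _ => mul_comm _ _
    · have h1 := hB (k - r) (by omega)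
      have h2 := pairing_powerSum_prod z c (k - r)
      rw [pairing_X_pow_mul _ _ (natDegree_prod_X_sub_C z).le, Finset.sum_range_succ,
        coeff_prod_X_sub_C, one_mul, Nat.sub_add_cancel (by omega)] at h1 h2
      rw [eq_neg_of_add_eq_zero_right h1, eq_neg_of_add_eq_zero_right h2]
      refine congrArg _ (Finset.sum_congr rfl fun l hl => ?_)
      have := Finset.mem_range.mp hl
      rw [ih _ (by omega) (by omega)]

theorem recPoly_powerSum {z : Fin r → ℂ} (c : Fin r → ℂ) :
    recPoly r (powerSum z c) =
      C (hankelCorner r (powerSum z c)).det * ∏ i, (X - C (z i)) := by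
  have := C_det_mul_eq (powerSum z c) (natDegree_prod_X_sub_C z).le
    fun k _ => pairing_powerSum_prod z c k
  rw [this, coeff_prod_X_sub_C, C_1, one_mul]

/-- Sums of `r` powers with distinct nonzero nodes and nonzero weights, up to `B` terms. -/
def IsGenericUpTo (r B : ℕ) (a : ℕ → ℂ) : Prop :=
  ∃ z c : Fin r → ℂ, Function.Injective z ∧ (∀ i, z i ≠ 0) ∧ (∀ i, c i ≠ 0) ∧
    ∀ k < B, a k = powerSum z c k

theorem pairing_congr {a b : ℕ → ℂ} {B k m : ℕ} (h : ∀ k < B, a k = b k) {q : ℂ[X]}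
    (hq : q.natDegree ≤ m) (hk : k + m < B) :
    pairing a (X ^ k * q) = pairing b (X ^ k * q) := by
  rw [pairing_X_pow_mul _ _ hq, pairing_X_pow_mul _ _ hq]
  refine Finset.sum_congr rfl fun l hl => ?_
  rw [h _ (by have := Finset.mem_range.mp hl; omega)]

/-- This trades nodes and weights for equations and inequations in the terms. Only k ≥ r is imposed,
the earlier equations being automatic. -/
theorem isGenericUpTo_iff {B : ℕ} (hB : 2 * r ≤ B) (a : ℕ → ℂ) :
    IsGenericUpTo r B a ↔ (hankelCorner r a).det ≠ 0 ∧
      (∀ k, r ≤ k → k + r < B → pairing a (X ^ k * recPoly r a) = 0) ∧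
      genericity r (recPoly r a) ≠ 0 := by
  constructor
  · rintro ⟨z, c, hz, hz0, hc, ha⟩
    have h1 : hankelCorner r a = hankelCorner r (powerSum z c) :=
      hankelCorner_congr fun k hk => ha k (by omega)
    have h2 : recPoly r a = recPoly r (powerSum z c) := recPoly_congr fun k hk => ha k (by omega)
    have hdet := (det_hankelCorner_powerSum_ne_zero_iff hz).mpr hc
    refine ⟨h1 ▸ hdet, fun k _ hk => ?_, ?_⟩
    · rw [pairing_congr ha (natDegree_recPoly_le _ _) hk, h2, recPoly_powerSum,
        pairing_X_pow_mul_C_mul, pairing_powerSum_prod, mul_zero]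
    · rw [h2, recPoly_powerSum]
      exact genericity_prod_ne_zero hz hz0 hdet
  · rintro ⟨hdet, hrec, hgen⟩
    obtain ⟨z, hz, hz0, heq⟩ :=
      exists_eq_prod_of_genericity_ne_zero (natDegree_recPoly_le r a) hgen
    rw [coeff_recPoly_self] at heq
    obtain ⟨c, hc⟩ := exists_powerSum_of_recursion hz a
    have hc := hc B fun k hk => by
      have : pairing a (X ^ k * recPoly r a) = 0 := by
        by_cases hkr : k < r
        · exact pairing_recPoly_of_lt a hkr
        · exact hrec k (by omega) hk
      rw [heq, pairing_X_pow_mul_C_mul] at this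
      exact (mul_eq_zero.mp this).resolve_left hdet
    refine ⟨z, c, hz, hz0, ?_, hc⟩
    have h1 : hankelCorner r a = hankelCorner r (powerSum z c) :=
      hankelCorner_congr fun k hk => hc k (by omega)
    rw [h1] at hdet
    exact (det_hankelCorner_powerSum_ne_zero_iff hz).mp hdet

end PowerSums

/-! ### The generic class as sums of exponentials. -/

section Generic

theorem corner_hankelCorner {N r : ℕ} (h : r ≤ N) (a : ℕ → ℂ) :
    corner h (hankelCorner N a) = hankelCorner r a := rfl

theorem hankelCorner_mem_hankel (N : ℕ) (a : ℕ → ℂ) : hankelCorner N a ∈ hankel N := by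
  intro j l j' l' h
  simp only [hankelCorner, Matrix.of_apply, h]

theorem exists_eq_hankelCorner {N : ℕ} {A : Mat N} (hA : A ∈ hankel N) :
    ∃ a : ℕ → ℂ, A = hankelCorner N a := by
  refine ⟨fun k => if h : ∃ p : Fin N × Fin N, (p.1 : ℕ) + p.2 = k then
    A h.choose.1 h.choose.2 else 0, ?_⟩
  ext j l
  have h : ∃ p : Fin N × Fin N, (p.1 : ℕ) + p.2 = (j : ℕ) + l := ⟨(j, l), rfl⟩
  simp only [hankelCorner, Matrix.of_apply]
  rw [dif_pos h]
  exact hA _ _ _ _ h.choose_spec.symm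

theorem hankelCorner_eq_iff {N : ℕ} {a b : ℕ → ℂ} :
    hankelCorner N a = hankelCorner N b ↔ ∀ k < 2 * N - 1, a k = b k := by
  constructor
  · intro h k hk
    by_cases hkN : k < N
    · have := congrFun (congrFun h ⟨k, hkN⟩) ⟨0, by omega⟩
      simpa [hankelCorner] using this
    · have := congrFun (congrFun h ⟨N - 1, by omega⟩) ⟨k - (N - 1), by omega⟩
      simp only [hankelCorner, Matrix.of_apply] at this
      rwa [Nat.add_sub_cancel' (by omega)] at this
  · intro h
    exact hankelCorner_congr fun k hk => h k (by omega)

theorem hankelCorner_mem_hankelGeneric_iff {N r : ℕ} (hr : r < N) (a : ℕ → ℂ) :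
    hankelCorner N a ∈ hankelGeneric N r hr.le ↔ IsGenericUpTo r (2 * N - 1) a := by
  constructor
  · rintro ⟨-, hdet, P, ⟨hP, hPd, f, hf, hrec⟩, hroots⟩
    have haf : ∀ k < 2 * N - 1, a k = f k :=
      hankelCorner_eq_iff.mp (by ext j l; exact hf j l)
    have hnd : P.roots.Nodup := by
      rw [Multiset.nodup_iff_count_le_one]
      intro z
      rw [count_roots]
      by_cases hz : P.IsRoot z
      · exact (hroots z hz).2.le
      · rw [rootMultiplicity_eq_zero hz]; exact zero_le_one
    obtain ⟨z, hz, hzP, heq⟩ := exists_eq_prod_of_nodup_roots hPd hnd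
    rw [hP.leadingCoeff, C_1, one_mul] at heq
    obtain ⟨c, hc⟩ := exists_powerSum_of_recursion hz f
    have hfc := hc (2 * N - 1) fun k _ => by
      rw [← heq, pairing_X_pow_mul f k hPd.le, hrec]
    have hac : ∀ k < 2 * N - 1, a k = powerSum z c k := fun k hk =>
      (haf k hk).trans (hfc k hk)
    refine ⟨z, c, hz, fun i => (hroots _ ((mem_roots hP.ne_zero).mp (hzP i))).1, ?_, hac⟩
    rw [corner_hankelCorner, hankelCorner_congr fun k hk => hac k (by omega)] at hdet
    exact (det_hankelCorner_powerSum_ne_zero_iff hz).mp hdet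
  · rintro ⟨z, c, hz, hz0, hc, ha⟩
    rw [hankelCorner_eq_iff.mpr ha]
    refine ⟨⟨rank_hankelCorner_powerSum_le N z c, hankelCorner_mem_hankel _ _⟩,
      (det_hankelCorner_powerSum_ne_zero_iff hz).mpr hc, ∏ i, (X - C (z i)),
      ⟨monic_prod_X_sub_C z, natDegree_prod_X_sub_C z, powerSum z c, fun _ _ => rfl,
        fun k => ?_⟩, fun w hw => ?_⟩
    · rw [← pairing_X_pow_mul _ _ (natDegree_prod_X_sub_C z).le, pairing_powerSum_prod]
    · have h1 : (∏ i, (X - C (z i))).Separable := separable_prod_X_sub_C_iff.mpr hz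
      refine ⟨?_, le_antisymm (rootMultiplicity_le_one_of_separable h1 w)
        ((rootMultiplicity_pos (monic_prod_X_sub_C z).ne_zero).mpr hw)⟩
      rw [IsRoot, eval_prod, Finset.prod_eq_zero_iff] at hw
      obtain ⟨i, -, hi⟩ := hw
      rw [eval_sub, eval_X, eval_C, sub_eq_zero] at hi
      exact hi ▸ hz0 i

end Generic

end HankelApprox

namespace HankelApprox

open Polynomial

/-! ### Inhomogeneous recursions. -/

section LinearRecursion

/-- The solution of an inhomogeneous linear recursion with zero initial values. -/
noncomputable def solveRecursion (q : ℂ[X]) (w : ℕ → ℂ) (k : ℕ) : ℂ :=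
  if _ : k < q.natDegree then 0 else
    (w (k - q.natDegree) - ∑ l : Fin q.natDegree,
      q.coeff l * solveRecursion q w (k - q.natDegree + l)) / q.leadingCoeff
termination_by k
decreasing_by omega

theorem solveRecursion_of_lt (q : ℂ[X]) (w : ℕ → ℂ) {k : ℕ} (hk : k < q.natDegree) :
    solveRecursion q w k = 0 := by
  rw [solveRecursion, dif_pos hk]

theorem pairing_solveRecursion {q : ℂ[X]} (hq : q ≠ 0) (w : ℕ → ℂ) (k : ℕ) :
    pairing (solveRecursion q w) (X ^ k * q) = w k := by
  rw [pairing_X_pow_mul _ _ le_rfl, Finset.sum_range_succ, coeff_natDegree, Finset.sum_range,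
    solveRecursion.eq_1 q w (k + q.natDegree), dif_neg (by omega), Nat.add_sub_cancel,
    mul_div_cancel₀ _ (leadingCoeff_ne_zero.mpr hq)]
  ring

end LinearRecursion

/-! ### Finite sequences as coordinates on Hankel matrices. -/

section Sequences

/-- Extension of a finite sequence by zero. -/
def extend (B : ℕ) : (Fin B → ℂ) →ₗ[ℂ] (ℕ → ℂ) where
  toFun f k := if h : k < B then f ⟨k, h⟩ else 0
  map_add' f g := by ext k; by_cases h : k < B <;> simp [h]
  map_smul' c f := by ext k; by_cases h : k < B <;> simp [h]

theorem extend_of_lt {B : ℕ} (f : Fin B → ℂ) {k : ℕ} (h : k < B) : extend B f k = f ⟨k, h⟩ :=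
  dif_pos h

theorem extend_truncate {B : ℕ} (a : ℕ → ℂ) {k : ℕ} (h : k < B) :
    extend B (fun i => a i) k = a k :=
  dif_pos h

theorem contDiff_extend {B : ℕ} (k : ℕ) : ContDiff ℝ ∞ fun f : Fin B → ℂ => extend B f k := by
  by_cases h : k < B
  · simp only [extend_of_lt _ h]
    exact contDiff_apply ℝ ℂ _
  · have : (fun f : Fin B → ℂ => extend B f k) = fun _ => 0 := funext fun f => dif_neg h
    rw [this]
    exact contDiff_const

/-- The first `m` terms of a finite sequence. -/
noncomputable def head (B m : ℕ) : (Fin B → ℂ) →L[ℝ] (Fin m → ℂ) :=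
  LinearMap.toContinuousLinearMap
    { toFun := fun f i => extend B f i
      map_add' := fun f g => by ext i; simp
      map_smul' := fun c f => by ext i; by_cases h : (i : ℕ) < B <;> simp [extend, h] }

theorem head_apply {B m : ℕ} (f : Fin B → ℂ) (i : Fin m) : head B m f i = extend B f i := rfl

theorem finrank_real_fin_fun (m : ℕ) : Module.finrank ℝ (Fin m → ℂ) = 2 * m := by
  rw [Module.finrank_pi_fintype]
  simp [mul_comm]

/-- The Hankel matrix of order `N` of a finite sequence. -/
noncomputable def hankelMap (N : ℕ) : (Fin (2 * N - 1) → ℂ) →L[ℝ] Mat N :=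
  LinearMap.toContinuousLinearMap
    { toFun := fun f => hankelCorner N (extend (2 * N - 1) f)
      map_add' := fun f g => by ext i j; simp [hankelCorner]
      map_smul' := fun c f => by
        ext i j
        by_cases h : (i : ℕ) + j < 2 * N - 1 <;> simp [hankelCorner, extend, h] }

theorem hankelMap_apply {N : ℕ} (f : Fin (2 * N - 1) → ℂ) :
    hankelMap N f = hankelCorner N (extend (2 * N - 1) f) := rfl

theorem hankelMap_truncate {N : ℕ} (a : ℕ → ℂ) :
    hankelMap N (fun i => a i) = hankelCorner N a :=
  hankelCorner_eq_iff.mpr fun _ hk => extend_truncate a hk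

theorem hankelMap_injective (N : ℕ) : Function.Injective (hankelMap N) := by
  intro f g h
  ext i
  rw [hankelMap_apply, hankelMap_apply] at h
  have := hankelCorner_eq_iff.mp h i i.2
  rwa [extend_of_lt _ i.2, extend_of_lt _ i.2] at this

theorem range_hankelMap (N : ℕ) : Set.range (hankelMap N) = hankel N := by
  ext A
  constructor
  · rintro ⟨f, rfl⟩
    rw [hankelMap_apply]
    exact hankelCorner_mem_hankel N _
  · intro hA
    obtain ⟨a, rfl⟩ := exists_eq_hankelCorner hA
    exact ⟨_, hankelMap_truncate a⟩

/-- The sequence of indeterminates. -/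
noncomputable def genericSeq (m : ℕ) (k : ℕ) : MvPolynomial (Fin m) ℂ :=
  if h : k < m then MvPolynomial.X ⟨k, h⟩ else 0

theorem recPoly_eq_map_genericSeq (s : ℕ) (a : ℕ → ℂ) :
    recPoly s a = (recPoly s (genericSeq (2 * s))).map
      (MvPolynomial.eval fun i : Fin (2 * s) => a i) := by
  rw [← recPoly_map]
  exact recPoly_congr fun k hk => by simp [genericSeq, hk]

theorem coeff_recPoly_extend {B : ℕ} (s : ℕ) (f : Fin B → ℂ) (l : ℕ) :
    (recPoly s (extend B f)).coeff l =
      MvPolynomial.eval (head B (2 * s) f) ((recPoly s (genericSeq (2 * s))).coeff l) := by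
  rw [recPoly_eq_map_genericSeq, coeff_map]
  rfl

theorem contDiff_coeff_recPoly_extend {B : ℕ} (s l : ℕ) :
    ContDiff ℝ ∞ fun f : Fin B → ℂ => (recPoly s (extend B f)).coeff l := by
  simp only [coeff_recPoly_extend]
  exact (((contDiff_eval_mvPolynomial _).restrict_scalars ℝ).of_le le_top).comp
    (head B (2 * s)).contDiff

end Sequences

/-! ### Strata by order of recursion. -/

section Strata

theorem fderiv_apply_of_affine {V W : Type*} [NormedAddCommGroup V] [NormedSpace ℝ V]
    [NormedAddCommGroup W] [NormedSpace ℝ W] {E : V → W} {x v : V} {d : W}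
    (hE : DifferentiableAt ℝ E x) (h : ∀ t : ℝ, E (x + t • v) = E x + t • d) :
    fderiv ℝ E x v = d := by
  rw [← hE.lineDeriv_eq_fderiv]
  refine HasLineDerivAt.lineDeriv ?_
  rw [HasLineDerivAt]
  simp only [h]
  simpa using ((hasDerivAt_id (0 : ℝ)).smul_const d).const_add (E x)

/-- The finite sequences with nonsingular corner of order `s` satisfying the corresponding
recursion except possibly in the last `r - s` terms, with conditions on the first terms. -/
def stratum (B r s : ℕ) {e : ℕ} (O : Set (Fin (2 * s) → ℂ))
    (g : (Fin (2 * s) → ℂ) → Fin e → ℂ) : Set (Fin B → ℂ) :=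
  {f | (hankelCorner s (extend B f)).det ≠ 0 ∧
    (∀ k, s ≤ k → k + r < B → pairing (extend B f) (X ^ k * recPoly s (extend B f)) = 0) ∧
    head B (2 * s) f ∈ O ∧ g (head B (2 * s) f) = 0}

theorem contDiff_pairing_recPoly {B : ℕ} (s k : ℕ) :
    ContDiff ℝ ∞ fun f : Fin B → ℂ =>
      pairing (extend B f) (X ^ k * recPoly s (extend B f)) := by
  simp only [pairing_X_pow_mul _ _ (natDegree_recPoly_le s _)]
  exact ContDiff.sum fun l _ => (contDiff_coeff_recPoly_extend s l).mul (contDiff_extend _)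

theorem fderiv_pairing_recPoly {B : ℕ} (s k : ℕ) (x v : Fin B → ℂ)
    (hv : ∀ k < 2 * s, extend B v k = 0) :
    fderiv ℝ (fun f : Fin B → ℂ => pairing (extend B f) (X ^ k * recPoly s (extend B f))) x v =
      pairing (extend B v) (X ^ k * recPoly s (extend B x)) := by
  refine fderiv_apply_of_affine ((contDiff_pairing_recPoly s k).differentiable (by simp) x) ?_
  intro t
  have hsm : extend B (t • v) = (t : ℂ) • extend B v := by
    rw [← map_smul]
    rfl
  have h1 : recPoly s (extend B (x + t • v)) = recPoly s (extend B x) :=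
    recPoly_congr fun l hl => by simp [hsm, hv l hl]
  rw [h1, map_add, hsm]
  simp only [pairing_X_pow_mul _ _ (natDegree_recPoly_le s _), Pi.add_apply, Pi.smul_apply,
    mul_add, Finset.sum_add_distrib, Finset.smul_sum, smul_eq_mul, Complex.real_smul]
  congr 1
  exact Finset.sum_congr rfl fun l _ => by ring

/-- The equation of index k ≥ s has its top term at k + s ≥ 2s, so it can be solved successively
with the first 2s terms kept zero. Hence the shift by `s` in the solution. -/
theorem exists_extend_pairing_eq {B s r : ℕ} (hs : s ≤ r) (q : ℂ[X]) (hq : q.natDegree = s)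
    (hq0 : q ≠ 0) (w : ℕ → ℂ) :
    ∃ v : Fin B → ℂ, (∀ k < 2 * s, extend B v k = 0) ∧
      ∀ k, s ≤ k → k + r < B → pairing (extend B v) (X ^ k * q) = w k := by
  let a : ℕ → ℂ := fun k => if k < s then 0 else solveRecursion q (fun j => w (s + j)) (k - s)
  have ha : ∀ k < 2 * s, a k = 0 := by
    intro k hk
    by_cases hks : k < s
    · simp [a, hks]
    · simp only [a, hks, if_false]
      exact solveRecursion_of_lt _ _ (by omega)
  refine ⟨fun i => a i, fun k hk => ?_, fun k hk hkB => ?_⟩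
  · by_cases hkB : k < B
    · rw [extend_truncate a hkB, ha k hk]
    · exact dif_neg hkB
  · rw [pairing_congr (fun k hk => extend_truncate a hk) hq.le (by omega)]
    obtain ⟨j, rfl⟩ := Nat.exists_eq_add_of_le hk
    rw [← pairing_solveRecursion hq0 (fun j => w (s + j)) j, pairing_X_pow_mul_eq_shift,
      pairing_X_pow_mul_eq_shift]
    congr 2
    ext l
    have : ¬ s + j + l < s := by omega
    simp only [a, this, if_false]
    congr 1
    omega

/-- Among B complex coordinates there are B - r - s recursion equations and `e` conditions on the
first 2s terms, leaving complex dimension r + s - e. -/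
theorem isSubmanifold_stratum {N r s e d : ℕ} (hr : r < N) (hs : s ≤ r)
    (hd : d + 2 * e = 2 * (r + s)) {O : Set (Fin (2 * s) → ℂ)} (hO : IsOpen O)
    {g : (Fin (2 * s) → ℂ) → Fin e → ℂ} (hg : ContDiff ℝ ∞ g)
    (hsurj : ∀ u ∈ O, g u = 0 → Function.Surjective (fderiv ℝ g u)) :
    IsSubmanifold d (hankelMap N '' stratum (2 * N - 1) r s O g) := by
  set B := 2 * N - 1 with hB
  have hn : (∞ : WithTop ℕ∞) ≠ 0 := by simp
  let κ := Fin (B - r - s)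
  let E : κ → (Fin B → ℂ) → ℂ := fun j f =>
    pairing (extend B f) (X ^ (s + (j : ℕ)) * recPoly s (extend B f))
  have hE : ∀ j, ContDiff ℝ ∞ (E j) := fun j => contDiff_pairing_recPoly s _
  have hgh : ContDiff ℝ ∞ fun f : Fin B → ℂ => g (head B (2 * s) f) :=
    hg.comp (head B (2 * s)).contDiff
  refine isSubmanifold_image_of_submersion (G := (Fin e → ℂ) × (κ → ℂ)) (hankelMap N)
    (hankelMap_injective N) _ ?_ ?_
  · rintro x ⟨hdet, hrec, hxO, hgx⟩
    refine ⟨fun f => (g (head B (2 * s) f), fun j => E j f), hgh.prodMk (contDiff_pi.mpr hE),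
      ?_, ?_⟩
    · rintro ⟨c, w⟩
      have hd1 : DifferentiableAt ℝ (fun f : Fin B → ℂ => g (head B (2 * s) f)) x :=
        hgh.differentiable hn x
      have hd2 : ∀ j, DifferentiableAt ℝ (E j) x := fun j => (hE j).differentiable hn x
      have key : ∀ v, fderiv ℝ (fun f : Fin B → ℂ => (g (head B (2 * s) f), fun j => E j f)) x v =
          (fderiv ℝ g (head B (2 * s) x) (head B (2 * s) v), fun j => fderiv ℝ (E j) x v) := by
        intro v
        rw [hd1.fderiv_prodMk (differentiableAt_pi.mpr hd2), fderiv_pi hd2]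
        have : fderiv ℝ (fun f : Fin B → ℂ => g (head B (2 * s) f)) x =
            (fderiv ℝ g (head B (2 * s) x)).comp (head B (2 * s)) := by
          rw [show (fun f : Fin B → ℂ => g (head B (2 * s) f)) = g ∘ head B (2 * s) from rfl,
            fderiv_comp _ (hg.differentiable hn _) (head B (2 * s)).differentiableAt,
            ContinuousLinearMap.fderiv]
        rw [this]
        rfl
      obtain ⟨u, hu⟩ := hsurj _ hxO hgx c
      let v₁ : Fin B → ℂ := fun i => extend (2 * s) u i
      have hv₁ : head B (2 * s) v₁ = u := by
        ext i
        rw [head_apply, extend_truncate _ (by omega), extend_of_lt _ i.2]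
      have hcoeff : (recPoly s (extend B x)).coeff s ≠ 0 := by rwa [coeff_recPoly_self]
      -- The derivative is block triangular: `v₁` attains `c` through the first 2s terms, and `v₂`,
      -- zero there, corrects the recursion equations.
      obtain ⟨v₂, hv₂, hpair⟩ := exists_extend_pairing_eq (B := B) hs (recPoly s (extend B x))
        (le_antisymm (natDegree_recPoly_le _ _) (le_natDegree_of_ne_zero hcoeff))
        (by intro h0; rw [h0] at hcoeff; simp at hcoeff)
        (fun k => if h : k - s < B - r - s then
          w ⟨k - s, h⟩ - fderiv ℝ (E ⟨k - s, h⟩) x v₁ else 0)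
      have hhead : head B (2 * s) v₂ = 0 := by
        ext i
        exact hv₂ i i.2
      refine ⟨v₁ + v₂, ?_⟩
      rw [key, map_add, hv₁, hhead, add_zero, hu]
      refine Prod.ext rfl (funext fun j => ?_)
      have hj := j.2
      change fderiv ℝ (E j) x (v₁ + v₂) = w j
      rw [map_add, fderiv_pairing_recPoly s _ x v₂ hv₂, hpair _ (by omega) (by omega)]
      simp only [Nat.add_sub_cancel_left, j.2, dif_pos, Fin.eta]
      ring
    · have h1 : ∀ᶠ y in nhds x, (recPoly s (extend B y)).coeff s ≠ 0 :=
        (contDiff_coeff_recPoly_extend s s).continuous.continuousAt.eventually_ne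
          (by rwa [coeff_recPoly_self])
      have h2 : ∀ᶠ y in nhds x, head B (2 * s) y ∈ O :=
        (head B (2 * s)).continuous.continuousAt.eventually (hO.mem_nhds hxO)
      filter_upwards [h1, h2] with y hy1 hy2
      rw [Set.mem_ofPred_eq, coeff_recPoly_self] at hy1
      constructor
      · rintro ⟨-, hy, -, hgy⟩
        refine Prod.ext hgy (funext fun j => ?_)
        have hj := j.2
        exact hy _ (by omega) (by omega)
      · intro h
        refine ⟨hy1, fun k hk hkB => ?_, hy2, congrArg Prod.fst h⟩
        have := congrFun (congrArg Prod.snd h) ⟨k - s, by omega⟩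
        change pairing (extend B y) (X ^ (s + (k - s)) * recPoly s (extend B y)) = 0 at this
        rwa [Nat.add_sub_cancel' hk] at this
  · rw [Module.finrank_prod, finrank_real_fin_fun, finrank_real_fin_fun, finrank_real_fin_fun]
    omega

end Strata

end HankelApprox

namespace HankelApprox

open Polynomial Filter Topology

/-! ### Dimension of the generic class and thinness of its complement. -/

section Thin

theorem genericity_recPoly_eq_eval {B : ℕ} (r : ℕ) (f : Fin B → ℂ) :
    genericity r (recPoly r (extend B f)) = MvPolynomial.eval (head B (2 * r) f)
      (genericity r (recPoly r (genericSeq (2 * r)))) := by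
  rw [recPoly_eq_map_genericSeq, genericity_map]
  rfl

theorem natCast_succ_injective (r : ℕ) :
    Function.Injective fun i : Fin r => ((i : ℕ) : ℂ) + 1 := fun i j h =>
  Fin.ext (by simpa using h)

/-- It is nonzero at the sequence with nodes 1, ..., r and unit weights. -/
theorem genericity_genericSeq_ne_zero (r : ℕ) :
    genericity r (recPoly r (genericSeq (2 * r))) ≠ 0 := by
  intro h
  have h1 : IsGenericUpTo r (2 * r) (powerSum (fun i : Fin r => ((i : ℕ) : ℂ) + 1) 1) :=
    ⟨_, _, natCast_succ_injective r, fun i => Nat.cast_add_one_ne_zero _,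
      fun i => one_ne_zero, fun k _ => rfl⟩
  have h2 := ((isGenericUpTo_iff le_rfl _).mp h1).2.2
  rw [recPoly_eq_map_genericSeq, genericity_map, h, map_zero] at h2
  exact h2 rfl

theorem hankelGeneric_eq_image {N r : ℕ} (hr : r < N) :
    hankelGeneric N r hr.le = hankelMap N '' stratum (2 * N - 1) r r
      {u | MvPolynomial.eval u (genericity r (recPoly r (genericSeq (2 * r)))) ≠ 0}
      (fun _ => (0 : Fin 0 → ℂ)) := by
  have key : ∀ f, hankelMap N f ∈ hankelGeneric N r hr.le ↔ f ∈ stratum (2 * N - 1) r r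
      {u | MvPolynomial.eval u (genericity r (recPoly r (genericSeq (2 * r)))) ≠ 0}
      (fun _ => (0 : Fin 0 → ℂ)) := by
    intro f
    rw [hankelMap_apply, hankelCorner_mem_hankelGeneric_iff hr, isGenericUpTo_iff (by omega),
      genericity_recPoly_eq_eval]
    simp [stratum]
  ext A
  constructor
  · intro hA
    obtain ⟨f, rfl⟩ := (range_hankelMap N).ge hA.1.2
    exact ⟨f, (key f).mp hA, rfl⟩
  · rintro ⟨f, hf, rfl⟩
    exact (key f).mpr hf

theorem isSubmanifold_hankelGeneric {N r : ℕ} (hr : r < N) :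
    IsSubmanifold (4 * r) (hankelGeneric N r hr.le) := by
  rw [hankelGeneric_eq_image hr]
  refine isSubmanifold_stratum hr le_rfl (by omega) ?_ contDiff_const
    fun u _ _ c => ⟨0, Subsingleton.elim _ _⟩
  exact (MvPolynomial.continuous_eval _).isOpen_preimage _ isOpen_ne

theorem isThin_of_finite {E ι : Type*} [NormedAddCommGroup E] [NormedSpace ℝ E] [Finite ι]
    {d : ℕ} {T : Set E} (S : ι → Set E) (e : ι → ℕ)
    (h : ∀ i, e i < d ∧ IsSubmanifold (e i) (S i)) (hT : T ⊆ ⋃ i, S i) : IsThin d T := by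
  obtain ⟨n, ⟨φ⟩⟩ := Finite.exists_equiv_fin ι
  refine ⟨n, S ∘ φ.symm, e ∘ φ.symm, fun i => h _, hT.trans ?_⟩
  rw [← φ.symm.surjective.iUnion_comp S]
  rfl

theorem isThin_hankelRankLE_diff {N r : ℕ} (hr : r < N) :
    IsThin (4 * r) (hankelRankLE N r \ hankelGeneric N r hr.le) := by
  obtain ⟨T, hT⟩ := exists_hypersurface_cover (genericity_genericSeq_ne_zero r)
  let S₁ : Fin r → Set (Mat N) := fun s =>
    hankelMap N '' stratum (2 * N - 1) r s Set.univ (fun _ => (0 : Fin 0 → ℂ))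
  let S₂ : T → Set (Mat N) := fun t =>
    hankelMap N '' stratum (2 * N - 1) r r
      {u | MvPolynomial.eval u (MvPolynomial.pderiv t.1.2 t.1.1) ≠ 0}
      (fun u (_ : Fin 1) => MvPolynomial.eval u t.1.1)
  refine isThin_of_finite (Sum.elim S₁ S₂) (Sum.elim (fun s => 2 * (r + s)) fun _ => 4 * r - 2)
    ?_ ?_
  · rintro (s | t)
    · refine ⟨?_, isSubmanifold_stratum hr s.2.le (by simp) isOpen_univ contDiff_const
        fun u _ _ c => ⟨0, Subsingleton.elim _ _⟩⟩
      have := s.2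
      simp only [Sum.elim_inl]
      omega
    · have := t.1.2.2
      refine ⟨by simp only [Sum.elim_inr]; omega, isSubmanifold_stratum (e := 1) hr le_rfl
        (by simp only [Sum.elim_inr]; omega)
        ((MvPolynomial.continuous_eval _).isOpen_preimage _ isOpen_ne) ?_ ?_⟩
      · exact contDiff_pi.mpr fun _ =>
          ((contDiff_eval_mvPolynomial _).restrict_scalars ℝ).of_le le_top
      · intro u hu _ c
        obtain ⟨v, hv⟩ := fderiv_eval_mvPolynomial_surjective hu (c 0)
        refine ⟨v, ?_⟩
        have hdiff : DifferentiableAt ℝ (fun u => MvPolynomial.eval u t.1.1) u :=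
          ((contDiff_eval_mvPolynomial t.1.1).restrict_scalars ℝ).differentiable (by simp) u
        rw [fderiv_pi fun _ => hdiff]
        ext i
        rw [Subsingleton.elim i 0, ← hv]
        rfl
  · rintro A ⟨⟨hrank, hA⟩, hgen⟩
    obtain ⟨f, rfl⟩ := (range_hankelMap N).ge hA
    obtain ⟨p, hp, hpr, hdet, hrec⟩ := exists_recursion_of_rank_le hr hrank
    have heq := C_det_mul_eq (extend (2 * N - 1) f) (le_refl p.natDegree)
      fun k hk => hrec k (by omega)
    rw [coeff_natDegree, hp.leadingCoeff, C_1, one_mul] at heq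
    have hrec' : ∀ k, k + r < 2 * N - 1 → pairing (extend (2 * N - 1) f)
        (X ^ k * recPoly p.natDegree (extend (2 * N - 1) f)) = 0 := fun k hk => by
      rw [← heq, pairing_X_pow_mul_C_mul, hrec k hk, mul_zero]
    rw [Set.mem_iUnion]
    rcases hpr.lt_or_eq with hlt | hpd
    · exact ⟨Sum.inl ⟨p.natDegree, hlt⟩, f, ⟨hdet, fun k _ hk => hrec' k hk, trivial, rfl⟩, rfl⟩
    · rw [hpd] at hdet hrec'
      have h0 : genericity r (recPoly r (extend (2 * N - 1) f)) = 0 := by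
        by_contra h0
        exact hgen ((hankelCorner_mem_hankelGeneric_iff hr _).mpr
          ((isGenericUpTo_iff (by omega) _).mpr ⟨hdet, fun k _ hk => hrec' k hk, h0⟩))
      rw [genericity_recPoly_eq_eval] at h0
      obtain ⟨g, hg, hg0, hgd⟩ := hT _ h0
      exact ⟨Sum.inr ⟨g, hg⟩, f, ⟨hdet, fun k _ hk => hrec' k hk, hgd, funext fun _ => hg0⟩, rfl⟩

end Thin

/-! ### Density of the generic class. -/

section Dense

theorem eventually_eval_ne_zero {P : ℂ[X]} (hP : P ≠ 0) (x : ℂ) :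
    ∀ᶠ t in 𝓝[≠] x, P.eval t ≠ 0 := by
  refine nhdsNE_le_cofinite x ?_
  rw [mem_cofinite]
  simpa [Set.compl_ofPred] using finite_setOfPred_isRoot hP

/-- Adding the same small t to all weights makes them nonzero, except for finitely many t. -/
theorem powerSum_mem_closure {r B : ℕ} {z : Fin r → ℂ} (hz : Function.Injective z)
    (hz0 : ∀ i, z i ≠ 0) (c : Fin r → ℂ) :
    (fun k : Fin B => powerSum z c k) ∈ closure {f | IsGenericUpTo r B (extend B f)} := by
  let γ : ℂ → Fin B → ℂ := fun t k => powerSum z (fun i => c i + t) k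
  have hγ : Continuous γ := by
    refine continuous_pi fun k => ?_
    unfold γ powerSum
    fun_prop
  have hlim : Tendsto γ (𝓝[≠] 0) (𝓝 (γ 0)) := hγ.continuousAt.tendsto.mono_left nhdsWithin_le_nhds
  rw [show (fun k : Fin B => powerSum z c k) = γ 0 by simp [γ]]
  have hP : ∏ i, (X + C (c i)) ≠ 0 := (monic_prod_of_monic _ _ fun i _ => monic_X_add_C _).ne_zero
  refine mem_closure_of_tendsto hlim ((eventually_eval_ne_zero hP 0).mono fun t ht => ?_)
  rw [eval_prod, Finset.prod_ne_zero_iff] at ht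
  refine ⟨z, fun i => c i + t, hz, hz0, fun i => ?_, fun k hk => extend_truncate _ hk⟩
  have := ht i (Finset.mem_univ i)
  rwa [eval_add, eval_X, eval_C, add_comm] at this

/-- The matrix of the map sending a finite sequence to its pairings with `X ^ i * q`. -/
noncomputable def recMatrix (n B : ℕ) (q : ℂ[X]) : Matrix (Fin n) (Fin B) ℂ :=
  Matrix.of fun i k => (X ^ (i : ℕ) * q).coeff k

theorem recMatrix_mulVec {n B r : ℕ} (hn : n + r ≤ B) {q : ℂ[X]} (hq : q.natDegree ≤ r)
    (f : Fin B → ℂ) (i : Fin n) :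
    (recMatrix n B q).mulVec f i = pairing (extend B f) (X ^ (i : ℕ) * q) := by
  have hi := i.2
  rw [pairing_eq_sum (m := B - 1), Nat.sub_add_cancel (by omega), Finset.sum_range]
  · simp [recMatrix, Matrix.mulVec, dotProduct, extend_of_lt]
  · refine natDegree_mul_le.trans ?_
    rw [natDegree_X_pow]
    omega

theorem recMatrix_mulVec_surjective {n B r : ℕ} (hn : n + r ≤ B) {q : ℂ[X]}
    (hq : q.natDegree ≤ r) (hq0 : q ≠ 0) :
    Function.Surjective (recMatrix n B q).mulVec := by
  intro w
  refine ⟨fun k => solveRecursion q (extend n w) k, funext fun i => ?_⟩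
  have hi := i.2
  rw [recMatrix_mulVec hn hq, pairing_congr (fun k hk => extend_truncate _ hk) hq (by omega),
    pairing_solveRecursion hq0, extend_of_lt _ i.2]

theorem recMatrix_add_smul (n B : ℕ) (p q : ℂ[X]) (s t : ℂ) :
    recMatrix n B (C s * p + C t * q) = s • recMatrix n B p + t • recMatrix n B q := by
  ext i k
  simp only [recMatrix, Matrix.of_apply, Matrix.add_apply, Matrix.smul_apply, smul_eq_mul]
  rw [show X ^ (i : ℕ) * (C s * p + C t * q) = C s * (X ^ (i : ℕ) * p) + C t * (X ^ (i : ℕ) * q) by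
    ring, coeff_add, coeff_C_mul, coeff_C_mul]

/-- Along the line through `p` and `q` the genericity is a polynomial in t, nonzero at t = 1. -/
theorem eventually_genericity_ne_zero {r : ℕ} (p : ℂ[X]) {q : ℂ[X]} (hq : genericity r q ≠ 0) :
    ∀ᶠ t in 𝓝[≠] (0 : ℂ), genericity r (C (1 - t) * p + C t * q) ≠ 0 := by
  let Q : ℂ[X][X] := C (1 - X) * p.map C + C X * q.map C
  have hQ : ∀ t : ℂ, Q.map (evalRingHom t) = C (1 - t) * p + C t * q := by
    intro t
    have h : (evalRingHom t).comp C = RingHom.id ℂ := by ext; simp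
    simp [Q, Polynomial.map_map, h]
  have heval : ∀ t : ℂ, (genericity r Q).eval t = genericity r (C (1 - t) * p + C t * q) := by
    intro t
    rw [← hQ, genericity_map]
    rfl
  have hne : genericity r Q ≠ 0 := by
    intro h
    have := heval 1
    rw [h] at this
    simp at this
    exact hq this.symm
  exact (eventually_eval_ne_zero hne 0).mono fun t ht => by rwa [← heval]

theorem mem_closure_of_recursion {r B : ℕ} (hrB : r ≤ B) {p : ℂ[X]} (hp0 : p ≠ 0)
    (hp : p.natDegree ≤ r) (f : Fin B → ℂ)
    (hf : ∀ k, k + r < B → pairing (extend B f) (X ^ k * p) = 0) :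
    f ∈ closure {f | IsGenericUpTo r B (extend B f)} := by
  set q : ℂ[X] := ∏ i : Fin r, (X - C (((i : ℕ) : ℂ) + 1)) with hqdef
  have hq : q.natDegree ≤ r := (natDegree_prod_X_sub_C _).le
  have hqg : genericity r q ≠ 0 := by
    have := genericity_prod_ne_zero (natCast_succ_injective r)
      (fun i => Nat.cast_add_one_ne_zero _) one_ne_zero
    rwa [C_1, one_mul] at this
  have hn : B - r + r ≤ B := by omega
  obtain ⟨R, hR⟩ := Matrix.mulVec_surjective_iff_exists_right_inverse.mp
    (recMatrix_mulVec_surjective hn hp hp0)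
  let M : ℂ → Matrix (Fin (B - r)) (Fin B) ℂ := fun t => recMatrix (B - r) B (C (1 - t) * p + C t * q)
  have hM : Continuous M := by
    simp only [M, recMatrix_add_smul]
    fun_prop
  -- With `R` a right inverse of `M 0`, this is the projection of `f` to the kernel of `M t`, with
  -- the denominator det(M t R) cleared; it equals `f` at t = 0.
  let γ : ℂ → Fin B → ℂ := fun t =>
    (M t * R).det • f - R.mulVec ((M t * R).adjugate.mulVec ((M t).mulVec f))
  have hγ : Continuous γ := by
    have h1 : Continuous fun t => M t * R := hM.matrix_mul continuous_const
    exact (h1.matrix_det.smul continuous_const).sub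
      (continuous_const.matrix_mulVec (h1.matrix_adjugate.matrix_mulVec
        (hM.matrix_mulVec continuous_const)))
  have hγ0 : γ 0 = f := by
    have h1 : M 0 = recMatrix (B - r) B p := by simp [M]
    have h2 : (M 0).mulVec f = 0 := by
      ext i
      have hi := i.2
      rw [h1, recMatrix_mulVec hn hp, hf _ (by omega), Pi.zero_apply]
    simp only [γ, h2, Matrix.mulVec_zero, sub_zero]
    rw [h1, hR, Matrix.det_one, one_smul]
  have hker : ∀ t, (M t).mulVec (γ t) = 0 := by
    intro t
    simp only [γ]
    rw [Matrix.mulVec_sub, Matrix.mulVec_smul, Matrix.mulVec_mulVec, Matrix.mulVec_mulVec,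
      Matrix.mul_adjugate, Matrix.smul_mulVec, Matrix.one_mulVec, sub_self]
  have hlim : Tendsto γ (𝓝[≠] 0) (𝓝 f) := by
    rw [← hγ0]
    exact hγ.continuousAt.tendsto.mono_left nhdsWithin_le_nhds
  -- The deformed sequences have good nodes but possibly zero weights, so they are only known to lie
  -- in the closure.
  rw [← closure_closure]
  refine mem_closure_of_tendsto hlim ((eventually_genericity_ne_zero p hqg).mono fun t ht => ?_)
  have hd : (C (1 - t) * p + C t * q).natDegree ≤ r := natDegree_add_le_of_degree_le
    ((natDegree_C_mul_le _ _).trans hp) ((natDegree_C_mul_le _ _).trans hq)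
  obtain ⟨z, hz, hz0, heq⟩ := exists_eq_prod_of_genericity_ne_zero hd ht
  obtain ⟨c, hc⟩ := exists_powerSum_of_recursion hz (extend B (γ t))
  have hc := hc B fun k hk => by
    have h1 := congrFun (hker t) ⟨k, by omega⟩
    rw [recMatrix_mulVec hn hd, heq, pairing_X_pow_mul_C_mul] at h1
    exact (mul_eq_zero.mp h1).resolve_left (left_ne_zero_of_mul ht)
  have : γ t = fun k : Fin B => powerSum z c k := by
    ext k
    rw [← hc k k.2, extend_of_lt _ k.2]
  rw [this]
  exact powerSum_mem_closure hz hz0 c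

theorem hankelRankLE_subset_closure {N r : ℕ} (hr : r < N) :
    hankelRankLE N r ⊆ closure (hankelGeneric N r hr.le) := by
  rintro A ⟨hrank, hA⟩
  obtain ⟨f, rfl⟩ := (range_hankelMap N).ge hA
  obtain ⟨p, hp, hpr, -, hrec⟩ := exists_recursion_of_rank_le hr hrank
  have h := mem_closure_of_recursion (by omega) hp.ne_zero hpr f hrec
  refine closure_mono ?_ (image_closure_subset_closure_image (hankelMap N).continuous ⟨f, h, rfl⟩)
  rintro _ ⟨g, hg, rfl⟩
  exact (hankelCorner_mem_hankelGeneric_iff hr _).mpr hg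

end Dense

end HankelApprox

theorem theorem6 (N r : ℕ) (hr : r < N) :
    -- the Hankel matrices form a real linear subspace of dimension `2 (2 N - 1)`
    (∃ V : Submodule ℝ (HankelApprox.Mat N),
      (V : Set (HankelApprox.Mat N)) = HankelApprox.hankel N ∧
        Module.finrank ℝ V = 2 * (2 * N - 1)) ∧
    -- the generic class is a manifold of dimension `4 r`
    HankelApprox.IsSubmanifold (4 * r) (HankelApprox.hankelGeneric N r hr.le) ∧
    -- it is dense in the Hankel matrices of rank at most `r`
    HankelApprox.hankelRankLE N r ⊆ closure (HankelApprox.hankelGeneric N r hr.le) ∧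
    -- its complement there is thin
    HankelApprox.IsThin (4 * r)
      (HankelApprox.hankelRankLE N r \ HankelApprox.hankelGeneric N r hr.le) ∧
    -- the projection onto the matrices of rank at most `r` is well defined on it
    (∀ A ∈ HankelApprox.hankelGeneric N r hr.le,
      ∃! B : HankelApprox.Mat N,
        HankelApprox.IsClosestPoint (HankelApprox.rankLE N r) A B) := by
  refine ⟨⟨LinearMap.range (HankelApprox.hankelMap N).toLinearMap, ?_, ?_⟩,
    HankelApprox.isSubmanifold_hankelGeneric hr, HankelApprox.hankelRankLE_subset_closure hr,
    HankelApprox.isThin_hankelRankLE_diff hr, fun A hA => ⟨A, ⟨hA.1.1, fun C _ => ?_⟩, ?_⟩⟩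
  · exact HankelApprox.range_hankelMap N
  · rw [LinearMap.finrank_range_of_inj (HankelApprox.hankelMap_injective N),
      HankelApprox.finrank_real_fin_fun]
  -- `A` itself has rank at most `r`, so the minimal distance is zero and is attained only at `A`.
  · rw [sub_self, norm_zero]
    exact norm_nonneg _
  · rintro B ⟨-, hB⟩
    have h := hB A hA.1.1
    rw [sub_self, norm_zero] at h
    exact (sub_eq_zero.mp (norm_le_zero_iff.mp h)).symm
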